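/- Fix $j>0$. For a positive Borel measure $\mu$ on $[0,1]$ put $F(r;\mu)=\mu([r,1])$, $r\in[0,1]$, and write $\mu\le\nu$ if $F(r;\mu)\le F(r;\nu)$ for all $r\in[0,1]$. A nonnegative function $u\in L^\infty([0,1])$ is identified with the measure $u(r)\,dr$, and $D_0$ is the unit point mass at $0$. For $\delta>0$ let $\mathcal U_\delta$ be the set of measures $\mu=c\,D_0+\rho(r)\,dr$ with $c\ge 0$, $\rho\in L^\infty([0,1],\mathbb R_+)$ and $F(0;\rho)>j\delta$, and let $$K^{(\delta)}\mu=j\delta D_0+\mathbf 1_{[0,R_\delta(\mu)]}\,\mu,\qquad R_\delta(\mu)=\inf\{r\in[0,1]:F(r;\mu)=j\delta\}.$$ Let $$G^{\rm neum}_t(r,r')=\sum_{k\in\mathbb Z}\big(G_t(r,2k+r')+G_t(r,2k-r')\big),\qquad G_t(r,r')=\frac{e^{-(r-r')^2/(2t)}}{\sqrt{2\pi t}},$$ be the Neumann heat kernel on $[0,1]$, and let $G_t^{\rm neum}*\mu$ be the measure with density $r\mapsto\int G^{\rm neum}_t(r,r')\,\mu(dr')$. For $u\in L^\infty([0,1],\mathbb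 R_+)\cap\mathcal U_\delta$ define the lower and upper barriers by $S^{(\delta,\pm)}_0(u)=u$ and, for $n\ge1$, $$S^{(\delta,-)}_{n\delta}(u)=K^{(\delta)}\big(G^{\rm neum}_\delta*S^{(\delta,-)}_{(n-1)\delta}(u)\big),\qquad S^{(\delta,+)}_{n\delta}(u)=G^{\rm neum}_\delta*\big(K^{(\delta)}S^{(\delta,+)}_{(n-1)\delta}(u)\big).$$ **Theorem (Separated classes).** Let $u\in L^\infty([0,1],\mathbb R_+)$ with $F(0;u)>0$. Then $$S^{(\delta,-)}_t(u)\le S^{(\delta',+)}_t(u)$$ for all $\delta,\delta'>0$ and all $t$ such that $u\in\mathcal U_\delta\cap\mathcal U_{\delta'}$ and $t=k\delta=k'\delta'$ with $k,k'\in\mathbb N=\{0,1,2,\dots\}$. -/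

import Mathlib

open MeasureTheory
open scoped ENNReal NNReal

noncomputable section

namespace Barriers

/-- A macroscopic profile: a nonnegative element of `L^∞([0,1])` (any representative of it). -/
def IsProfile (ρ : unitInterval → ℝ) : Prop :=
  MemLp ρ ∞ (volume : Measure unitInterval) ∧ ∀ᵐ r ∂(volume : Measure unitInterval), 0 ≤ ρ r

/-- The positive Borel measure `ρ(r) dr` on `[0,1]`. -/
def ofDensity (ρ : unitInterval → ℝ) : Measure unitInterval :=
  (volume : Measure unitInterval).withDensity fun r => ENNReal.ofReal (ρ r)

/-- `F(r; μ) = μ([r,1])`. -/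
def F (r : unitInterval) (μ : Measure unitInterval) : ℝ≥0∞ := μ (Set.Icc r 1)

/-- The mass-transport order: `F(r; μ) ≤ F(r; ν)` for all `r ∈ [0,1]`. -/
def MassLE (μ ν : Measure unitInterval) : Prop := ∀ r : unitInterval, F r μ ≤ F r ν

/-- The set `𝒰_δ` of the measures `c D₀ + ρ(r) dr` with `c ≥ 0`, `ρ ∈ L^∞([0,1], ℝ₊)` and
`F(0; ρ) > jδ`. -/
def UDelta (j δ : ℝ) : Set (Measure unitInterval) :=
  {μ | ∃ (c : ℝ≥0) (ρ : unitInterval → ℝ), IsProfile ρ ∧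
    μ = c • Measure.dirac 0 + ofDensity ρ ∧ ENNReal.ofReal (j * δ) < F 0 (ofDensity ρ)}

/-- `R_δ(μ) = inf {r ∈ [0,1] : F(r; μ) = jδ}`. -/
def cutPoint (j δ : ℝ) (μ : Measure unitInterval) : unitInterval :=
  sInf {r | F r μ = ENNReal.ofReal (j * δ)}

/-- The cut-and-paste operator `K^{(δ)} μ = jδ D₀ + 1_{[0, R_δ(μ)]} μ`. -/
def cutPaste (j δ : ℝ) (μ : Measure unitInterval) : Measure unitInterval :=
  ENNReal.ofReal (j * δ) • Measure.dirac 0 + μ.restrict (Set.Icc 0 (cutPoint j δ μ))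

/-- The heat kernel on the line, `G_t(r, r') = exp(-(r - r')² / (2t)) / √(2πt)`. -/
def heatKernel (t r r' : ℝ) : ℝ :=
  Real.exp (-(r - r') ^ 2 / (2 * t)) / Real.sqrt (2 * Real.pi * t)

/-- The Green function of the heat equation on `[0,1]` with Neumann boundary conditions: the sum of
the heat kernel over the images `2k + r'` and `2k - r'`, `k ∈ ℤ`, of `r'` under repeated
reflections. The terms are nonnegative, and the sum is formed in `[0,∞]`. -/
def neumannKernel (t : ℝ) (r r' : unitInterval) : ℝ≥0∞ :=
  ∑' k : ℤ, (ENNReal.ofReal (heatKernel t r (2 * k + r')) +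
    ENNReal.ofReal (heatKernel t r (2 * k - r')))

/-- `G_t^{neum} * μ`, the measure with density `r ↦ ∫ G_t^{neum}(r, r') μ(dr')`. -/
def neumannFlow (t : ℝ) (μ : Measure unitInterval) : Measure unitInterval :=
  (volume : Measure unitInterval).withDensity fun r => ∫⁻ r', neumannKernel t r r' ∂μ

/-- The lower barrier `S^{(δ,-)}_{nδ}(μ)`. -/
def lowerBarrier (j δ : ℝ) (μ : Measure unitInterval) : ℕ → Measure unitInterval
  | 0 => μ
  | n + 1 => cutPaste j δ (neumannFlow δ (lowerBarrier j δ μ n))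

/-- The upper barrier `S^{(δ,+)}_{nδ}(μ)`. -/
def upperBarrier (j δ : ℝ) (μ : Measure unitInterval) : ℕ → Measure unitInterval
  | 0 => μ
  | n + 1 => neumannFlow δ (cutPaste j δ (upperBarrier j δ μ n))

end Barriers

end

/-!
Everything is expressed through the tail function `F r μ = μ [r, 1]`. Write `G_t` for the Neumann
flow and `K_a` for the removal of mass `a` from the right end and its reinsertion at `0`. On tails,
`K_a` keeps `F 0` and replaces `F r` by `F r - a` (truncated at `0`) for `r > 0` (`IsCut`,
`isCut_cutPaste`).

The central fact is that `F r μ ≤ F r ν + a` for all `r` implies the same for `G_t μ` and `G_t ν`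
(`F_neumannFlow_le_add`): the hypothesis says `μ ≤ ν + a D₁`, the flow is linear, conserves mass
and preserves the order, and `a D₁` has mass `a`. With `ν = K_a μ` this gives `K_a G_t ≤ G_t K_a`.
Together with `G_{s+t} = G_s G_t` it yields three comparisons: refining the time step increases the
lower barrier, refining it decreases the upper barrier, and for one and the same step the lower
barrier lies below the upper one. Since `kδ = k'δ'`, the step `d = δ/k' = δ'/k` refines both `δ`
and `δ'`, and the three comparisons chain up.

That the flow preserves the order amounts to the statement that its action on functions preserves
monotonicity (`monotone_heatOp`), because `MassLE` compares the integrals of increasing functions.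
By the method of images, that action is `f ↦ E f(fold (y + B_t))` with `B_t` a centred Gaussian and
`fold : ℝ → [0,1]` the quotient by reflections at the integers (`lintegral_neumannKernel`);
the semigroup property is then the convolution rule for Gaussians. For monotonicity, reflect about
the midpoint `c` of `y ≤ y'`: for `0 ≤ v ≤ 1` one has `fold (c - v) ≤ fold (c + v)`, so `f ≤ 1`
loses monotonicity by at most `P(|B_t| ≥ 1/2)` (`heatOp_le_add`). Splitting `t` into `n` equal
steps makes the total loss `n P(|B_{t/n}| ≥ 1/2)`, which tends to `0` by the Gaussian tail bound.
-/

namespace Barriers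

open ProbabilityTheory Set

/-! ### The folding map of the line onto the unit interval -/

/-- The folding map `ℝ → [0,1]`, sending `x` to its distance from the nearest even integer. It is
written as `arccos (cos (π x)) / π`, which makes its symmetries those of the cosine. -/
noncomputable def fold (x : ℝ) : unitInterval :=
  ⟨Real.arccos (Real.cos (Real.pi * x)) / Real.pi,
    div_nonneg (Real.arccos_nonneg _) Real.pi_pos.le,
    div_le_one_of_le₀ (Real.arccos_le_pi _) Real.pi_pos.le⟩

lemma continuous_fold : Continuous fold := by
  unfold fold
  fun_prop

@[fun_prop]
lemma measurable_fold : Measurable fold := continuous_fold.measurable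

lemma fold_coe (y : unitInterval) : fold y = y := by
  apply Subtype.ext
  change Real.arccos (Real.cos (Real.pi * y)) / Real.pi = y
  have h0 := y.2.1
  have h1 := y.2.2
  rw [Real.arccos_cos (by positivity) (by nlinarith [Real.pi_pos])]
  field_simp

lemma fold_eq_of_cos_eq {x y : ℝ} (h : Real.cos (Real.pi * x) = Real.cos (Real.pi * y)) :
    fold x = fold y := by
  unfold fold
  simp only [h]

lemma fold_neg (x : ℝ) : fold (-x) = fold x :=
  fold_eq_of_cos_eq (by rw [mul_neg, Real.cos_neg])

lemma fold_add_two_mul_int (x : ℝ) (k : ℤ) : fold (x + 2 * k) = fold x := by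
  refine fold_eq_of_cos_eq ?_
  rw [show Real.pi * (x + 2 * k) = Real.pi * x + k * (2 * Real.pi) by ring,
    Real.cos_add_int_mul_two_pi]

/-- `fold x` is obtained from `x` by reflections at integers. -/
lemma exists_int_coe_fold (x : ℝ) :
    ∃ k : ℤ, (fold x : ℝ) = x + 2 * k ∨ (fold x : ℝ) = -x + 2 * k := by
  have h : Real.cos (Real.pi * x) = Real.cos (Real.pi * (fold x : ℝ)) := by
    change _ = Real.cos (Real.pi * (Real.arccos (Real.cos (Real.pi * x)) / Real.pi))
    rw [mul_div_cancel₀ _ Real.pi_pos.ne', Real.cos_arccos (Real.neg_one_le_cos _)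
      (Real.cos_le_one _)]
  obtain ⟨k, hk⟩ := Real.cos_eq_cos_iff.1 h
  refine ⟨k, hk.imp (fun hk => ?_) fun hk => ?_⟩ <;>
    exact mul_left_cancel₀ Real.pi_pos.ne' (by linarith)

/-- Of two points symmetric about `c ∈ [0,1]` and at distance at most `1` from it, the right one folds
farther to the right. -/
lemma fold_sub_le_fold_add {c v : ℝ} (hc0 : 0 ≤ c) (hc1 : c ≤ 1) (hv0 : 0 ≤ v) (hv1 : v ≤ 1) :
    fold (c - v) ≤ fold (c + v) := by
  have hpi := Real.pi_pos
  have hc : 0 ≤ Real.sin (Real.pi * c) :=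
    Real.sin_nonneg_of_nonneg_of_le_pi (by positivity) (by nlinarith)
  have hv : 0 ≤ Real.sin (Real.pi * v) :=
    Real.sin_nonneg_of_nonneg_of_le_pi (by positivity) (by nlinarith)
  have h : Real.cos (Real.pi * (c + v)) ≤ Real.cos (Real.pi * (c - v)) := by
    rw [mul_add, mul_sub, Real.cos_add, Real.cos_sub]
    nlinarith [mul_nonneg hc hv]
  exact div_le_div_of_nonneg_right (Real.antitone_arccos h) hpi.le

/-! ### The Neumann heat semigroup on functions -/

/-- The Neumann heat operator on functions: `heatOp v f y = E f(fold (y + B))`, where `B` is a centred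
Gaussian of variance `v`, that is, Brownian motion on `[0,1]` reflected at both ends and started
at `y`. The choice `v = 0` gives the identity. -/
noncomputable def heatOp (v : ℝ≥0) (f : unitInterval → ℝ≥0∞) (y : unitInterval) : ℝ≥0∞ :=
  ∫⁻ z, f (fold (y + z)) ∂gaussianReal 0 v

@[fun_prop]
lemma measurable_heatOp {v : ℝ≥0} {f : unitInterval → ℝ≥0∞} (hf : Measurable f) :
    Measurable (heatOp v f) := by
  unfold heatOp
  refine Measurable.lintegral_prod_right' (f := fun p : unitInterval × ℝ => f (fold (p.1 + p.2))) ?_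
  fun_prop

lemma lintegral_gaussianReal_neg (v : ℝ≥0) {g : ℝ → ℝ≥0∞} (hg : Measurable g) :
    ∫⁻ z, g (-z) ∂gaussianReal 0 v = ∫⁻ z, g z ∂gaussianReal 0 v := by
  conv_rhs => rw [← neg_zero (G := ℝ), ← gaussianReal_map_neg, lintegral_map hg measurable_neg]

/-- The formula defining `heatOp v f` stays true when the starting point is not folded first; this is
what makes `heatOp` a semigroup. -/
lemma heatOp_fold (v : ℝ≥0) {f : unitInterval → ℝ≥0∞} (hf : Measurable f) (w : ℝ) :
    heatOp v f (fold w) = ∫⁻ z, f (fold (w + z)) ∂gaussianReal 0 v := by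
  obtain ⟨k, hk | hk⟩ := exists_int_coe_fold w
  · simp only [heatOp, hk, add_right_comm _ (2 * (k : ℝ)), fold_add_two_mul_int]
  · simp only [heatOp, hk, add_right_comm _ (2 * (k : ℝ)), fold_add_two_mul_int]
    rw [← lintegral_gaussianReal_neg v (by fun_prop)]
    refine lintegral_congr fun z => ?_
    rw [← neg_add, fold_neg]

lemma heatOp_add (s t : ℝ≥0) {f : unitInterval → ℝ≥0∞} (hf : Measurable f) :
    heatOp (s + t) f = heatOp s (heatOp t f) := by
  ext y
  have h := gaussianReal_conv_gaussianReal (m₁ := 0) (m₂ := 0) (v₁ := s) (v₂ := t)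
  rw [add_zero] at h
  rw [heatOp, ← h, Measure.lintegral_conv (by fun_prop), heatOp]
  refine lintegral_congr fun z => ?_
  rw [heatOp_fold _ hf]
  simp only [add_assoc]

lemma heatOp_zero {f : unitInterval → ℝ≥0∞} (hf : Measurable f) : heatOp 0 f = f := by
  ext y
  rw [heatOp, gaussianReal_zero_var, lintegral_dirac' _ (by fun_prop), add_zero, fold_coe]

lemma heatOp_one (v : ℝ≥0) : heatOp v (fun _ => 1) = fun _ => 1 := by
  ext y
  simp [heatOp]

lemma heatOp_le_one (v : ℝ≥0) {f : unitInterval → ℝ≥0∞} (hf : ∀ y, f y ≤ 1) (y : unitInterval) :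
    heatOp v f y ≤ 1 := by
  rw [← congrFun (heatOp_one v) y]
  exact lintegral_mono fun _ => hf _

/-! ### The method of images -/

/-- Integration over the line, cut into the images of `[0,1]` under reflections at the integers. -/
lemma lintegral_real_eq_tsum_images {H : ℝ → ℝ≥0∞} (hH : Measurable H) :
    ∫⁻ w, H w = ∫⁻ x : unitInterval, ∑' k : ℤ, (H (x - 2 * k) + H (2 * k - x)) := by
  have htile : ∫⁻ w, H w = ∑' k : ℤ, ∫⁻ w in Ioc (-1 + k • (2 : ℝ)) (-1 + (k + 1) • (2 : ℝ)), H w := by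
    rw [← lintegral_iUnion (fun _ => measurableSet_Ioc) (pairwise_disjoint_Ioc_add_zsmul _ _),
      iUnion_Ioc_add_zsmul two_pos, setLIntegral_univ]
  have hunit (g : ℝ → ℝ≥0∞) (hg : Measurable g) :
      ∫⁻ x : unitInterval, g x = ∫⁻ x in Ioc (0 : ℝ) 1, g x := by
    rw [unitInterval.measurePreserving_coe.lintegral_comp hg, unitInterval,
      restrict_Ioc_eq_restrict_Icc]
  have hcell (k : ℤ) : ∫⁻ w in Ioc (-1 + k • (2 : ℝ)) (-1 + (k + 1) • (2 : ℝ)), H w =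
      (∫⁻ x : unitInterval, H (x + 2 * k)) + ∫⁻ x : unitInterval, H (2 * k - x) := by
    have hsplit : Ioc (-1 + k • (2 : ℝ)) (-1 + (k + 1) • (2 : ℝ)) =
        Ioc (2 * (k : ℝ) - 1) (2 * k) ∪ Ioc (2 * (k : ℝ)) (2 * k + 1) := by
      rw [Ioc_union_Ioc_eq_Ioc (by linarith) (by linarith)]
      simp only [zsmul_eq_mul]; push_cast
      congr 1 <;> ring
    rw [hsplit, lintegral_union measurableSet_Ioc (Ioc_disjoint_Ioc_of_le le_rfl), add_comm]
    congr 1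
    · rw [hunit (fun x => H (x + 2 * k)) (by fun_prop),
        ← (measurePreserving_add_right volume (2 * (k : ℝ))).setLIntegral_comp_preimage
          measurableSet_Ioc hH]
      congr 2
      ext x; simp
    · rw [hunit (fun x => H (2 * k - x)) (by fun_prop),
        Measure.restrict_congr_set (Ico_ae_eq_Ioc (a := (0 : ℝ)) (b := 1) (μ := volume)).symm,
        ← (Measure.measurePreserving_sub_left volume
          (2 * (k : ℝ))).setLIntegral_comp_preimage measurableSet_Ioc hH]
      congr 2
      ext x; simp
  have hneg : ∑' k : ℤ, ∫⁻ x : unitInterval, H (x + 2 * k) =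
      ∑' k : ℤ, ∫⁻ x : unitInterval, H (x - 2 * k) := by
    rw [← (Equiv.neg ℤ).tsum_eq]
    simp [sub_eq_add_neg]
  rw [lintegral_tsum (fun _ => by fun_prop)]
  have hadd (k : ℤ) : ∫⁻ x : unitInterval, (H (x - 2 * k) + H (2 * k - x)) =
      (∫⁻ x : unitInterval, H (x - 2 * k)) + ∫⁻ x : unitInterval, H (2 * k - x) :=
    lintegral_add_left (by fun_prop) _
  rw [htile, tsum_congr hcell, tsum_congr hadd, ENNReal.tsum_add, ENNReal.tsum_add, hneg]

lemma ofReal_heatKernel {t : ℝ} (ht : 0 < t) (r r' : ℝ) :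
    ENNReal.ofReal (heatKernel t r r') = gaussianPDF 0 t.toNNReal (r - r') := by
  rw [gaussianPDF, gaussianPDFReal, heatKernel, Real.coe_toNNReal _ ht.le, sub_zero, div_eq_inv_mul]

@[fun_prop]
lemma measurable_neumannKernel (t : ℝ) :
    Measurable fun p : unitInterval × unitInterval => neumannKernel t p.1 p.2 := by
  unfold neumannKernel heatKernel
  fun_prop

lemma gaussianPDF_zero_neg (v : ℝ≥0) (x : ℝ) : gaussianPDF 0 v (-x) = gaussianPDF 0 v x := by
  simp [gaussianPDF, gaussianPDFReal]

lemma heatOp_eq_lintegral {v : ℝ≥0} (hv : v ≠ 0) {f : unitInterval → ℝ≥0∞} (hf : Measurable f)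
    (y : unitInterval) : heatOp v f y = ∫⁻ w, gaussianPDF 0 v (w - y) * f (fold w) := by
  rw [heatOp, gaussianReal_of_var_ne_zero _ hv,
    lintegral_withDensity_eq_lintegral_mul _ (measurable_gaussianPDF _ _) (by fun_prop),
    ← lintegral_sub_right_eq_self _ (y : ℝ)]
  simp

/-- The Neumann kernel is the transition density of `heatOp`. -/
lemma lintegral_neumannKernel {t : ℝ} (ht : 0 < t) {f : unitInterval → ℝ≥0∞} (hf : Measurable f)
    (y : unitInterval) : ∫⁻ x, f x * neumannKernel t x y = heatOp t.toNNReal f y := by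
  have hm := measurable_gaussianPDF 0 t.toNNReal
  rw [heatOp_eq_lintegral (by simpa using ht) hf, lintegral_real_eq_tsum_images (by fun_prop)]
  refine lintegral_congr fun x => ?_
  rw [neumannKernel, ← ENNReal.tsum_mul_left]
  refine tsum_congr fun k => ?_
  have h1 : fold (x - 2 * k) = x := by
    have := fold_add_two_mul_int x (-k)
    rw [fold_coe] at this
    rw [sub_eq_add_neg, ← mul_neg, ← Int.cast_neg, this]
  have h2 : fold (2 * k - x) = x := by
    rw [← fold_neg, neg_sub, h1]
  rw [h1, h2, ofReal_heatKernel ht, ofReal_heatKernel ht, ← gaussianPDF_zero_neg _ (x - (2 * k - y)),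
    mul_add, mul_comm, mul_comm (f x)]
  congr 3 <;> ring

lemma lintegral_neumannFlow {t : ℝ} (ht : 0 < t) (μ : Measure unitInterval) [SFinite μ]
    {f : unitInterval → ℝ≥0∞} (hf : Measurable f) :
    ∫⁻ x, f x ∂neumannFlow t μ = ∫⁻ y, heatOp t.toNNReal f y ∂μ := by
  have hN := measurable_neumannKernel t
  have hNx (x : unitInterval) : Measurable (neumannKernel t x) :=
    Measurable.of_uncurry_left (f := neumannKernel t) hN
  have hk : Measurable fun r => ∫⁻ r', neumannKernel t r r' ∂μ := hN.lintegral_prod_right'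
  rw [neumannFlow, lintegral_withDensity_eq_lintegral_mul _ hk hf]
  calc ∫⁻ x, (∫⁻ r', neumannKernel t x r' ∂μ) * f x
      = ∫⁻ x, ∫⁻ r', f x * neumannKernel t x r' ∂μ := by
        refine lintegral_congr fun x => ?_
        rw [lintegral_const_mul _ (hNx x), mul_comm]
    _ = ∫⁻ r', (∫⁻ x, f x * neumannKernel t x r') ∂μ :=
        lintegral_lintegral_swap (f := fun x r' => f x * neumannKernel t x r')
        (Measurable.mul (f := fun p : unitInterval × unitInterval => f p.1)
          (hf.comp measurable_fst) hN).aemeasurable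
    _ = ∫⁻ y, heatOp t.toNNReal f y ∂μ :=
        lintegral_congr fun y => lintegral_neumannKernel ht hf y

/-! ### The heat operator preserves monotonicity -/

lemma gaussianPDF_zero_le (v : ℝ≥0) {x y : ℝ} (h : |x| ≤ |y|) :
    gaussianPDF 0 v y ≤ gaussianPDF 0 v x := by
  have := sq_le_sq.2 h
  unfold gaussianPDF gaussianPDFReal
  simp only [sub_zero]
  gcongr

lemma lintegral_real_eq_lintegral_Ioi (c : ℝ) {h : ℝ → ℝ≥0∞} (hh : Measurable h) :
    ∫⁻ w, h w = ∫⁻ x in Ioi 0, (h (c + x) + h (c - x)) := by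
  rw [← lintegral_add_left_eq_self h c,
    ← lintegral_add_compl (fun x => h (c + x)) (measurableSet_Ioi (a := (0 : ℝ))),
    lintegral_add_left (by fun_prop), compl_Ioi]
  congr 1
  rw [← restrict_Iio_eq_restrict_Iic, ← (Measure.measurePreserving_neg volume).setLIntegral_comp_preimage
    measurableSet_Iio (by fun_prop)]
  simp [sub_eq_add_neg]

/-- One application of `heatOp v` to a function `f ≤ 1` that is increasing up to an error `η` gives a
function that is increasing up to `η` plus the probability of a Gaussian displacement of size at
least `1/2`. Pair the points `c + x` and `c - x` symmetric about the midpoint `c` of `y` and `y'`: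
for `x ≤ 1` the right point folds farther to the right and has the larger weight as seen from `y'`;
for `x > 1` both points are at distance at least `1/2` from `y` and from `y'`. -/
lemma heatOp_le_add {v : ℝ≥0} (hv : v ≠ 0) {f : unitInterval → ℝ≥0∞} (hf : Measurable f)
    (hf1 : ∀ y, f y ≤ 1) {η : ℝ≥0∞} (hη : ∀ y y', y ≤ y' → f y ≤ f y' + η)
    {y y' : unitInterval} (hy : y ≤ y') :
    heatOp v f y ≤ heatOp v f y' + (η + gaussianReal 0 v {x | 1 / 2 ≤ |x|}) := by
  set S : Set ℝ := {x | 1 / 2 ≤ |x|} with hS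
  have hSm : MeasurableSet S := measurableSet_le measurable_const (by fun_prop)
  set p := gaussianPDF 0 v with hp
  have hpm : Measurable p := measurable_gaussianPDF 0 v
  have hind : Measurable (S.indicator p) := hpm.indicator hSm
  have hy0 := y.2.1
  have hy1 := y'.2.2
  have hyy : (y : ℝ) ≤ y' := hy
  obtain ⟨c, hc⟩ : ∃ c : ℝ, c = (y + y') / 2 := ⟨_, rfl⟩
  obtain ⟨d, hd⟩ : ∃ d : ℝ, d = (y' - y) / 2 := ⟨_, rfl⟩
  have hsymm (x : ℝ) : p (-x) = p x := gaussianPDF_zero_neg v x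
  have e1 : heatOp v f y =
      ∫⁻ x in Ioi (0 : ℝ), (p (d + x) * f (fold (c + x)) + p (d - x) * f (fold (c - x))) := by
    rw [heatOp_eq_lintegral hv hf, lintegral_real_eq_lintegral_Ioi c (by fun_prop)]
    congr! 4 with x
    · rw [← hp]; congr 1; rw [hc, hd]; ring
    · rw [← hp]; congr 1; rw [hc, hd]; ring
  have e2 : heatOp v f y' =
      ∫⁻ x in Ioi (0 : ℝ), (p (d - x) * f (fold (c + x)) + p (d + x) * f (fold (c - x))) := by
    rw [heatOp_eq_lintegral hv hf, lintegral_real_eq_lintegral_Ioi c (by fun_prop)]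
    congr! 4 with x
    · rw [← hp, ← hsymm]; congr 1; rw [hc, hd]; ring
    · rw [← hp, ← hsymm]; congr 1; rw [hc, hd]; ring
  have e3 : gaussianReal 0 v S =
      ∫⁻ x in Ioi (0 : ℝ), (S.indicator p (d + x) + S.indicator p (d - x)) := by
    rw [gaussianReal_apply _ hv, ← lintegral_indicator hSm, lintegral_real_eq_lintegral_Ioi d hind]
  have e4 : ∫⁻ x in Ioi (0 : ℝ), η * p (d - x) ≤ η := by
    refine (setLIntegral_le_lintegral _ _).trans ?_
    rw [lintegral_const_mul _ (by fun_prop), lintegral_sub_left_eq_self,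
      lintegral_gaussianPDF_eq_one _ hv, mul_one]
  calc heatOp v f y
      ≤ ∫⁻ x in Ioi (0 : ℝ), ((p (d - x) * f (fold (c + x)) + p (d + x) * f (fold (c - x))) +
        (η * p (d - x) + (S.indicator p (d + x) + S.indicator p (d - x)))) := by
        rw [e1]
        refine setLIntegral_mono (by fun_prop) fun x hx => ?_
        have hx0 : 0 < x := hx
        rcases le_or_gt x 1 with hx1 | hx1
        -- The excess `w` of the weight of the nearer point multiplies the pair in the favourable order.
        · have hab := hη _ _ (fold_sub_le_fold_add (c := c) (v := x) (by linarith) (by linarith)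
            hx0.le hx1)
          have hpq : p (d + x) ≤ p (d - x) := by
            refine gaussianPDF_zero_le v (abs_le_abs (by linarith) (by linarith))
          obtain ⟨w, hw⟩ := exists_add_of_le hpq
          rw [hw]
          calc p (d + x) * f (fold (c + x)) + (p (d + x) + w) * f (fold (c - x))
              ≤ p (d + x) * f (fold (c + x)) + p (d + x) * f (fold (c - x)) +
                w * (f (fold (c + x)) + η) := by
                rw [add_mul, ← add_assoc]
                gcongr
            _ ≤ p (d + x) * f (fold (c + x)) + p (d + x) * f (fold (c - x)) +
                w * (f (fold (c + x)) + η) + (η * p (d + x) +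
                (S.indicator p (d + x) + S.indicator p (d - x))) := le_self_add
            _ = _ := by ring
        · have h1 : d + x ∈ S := by
            rw [hS, mem_ofPred_eq, abs_of_pos (by linarith)]; linarith
          have h2 : d - x ∈ S := by
            rw [hS, mem_ofPred_eq, abs_of_neg (by linarith)]; linarith
          rw [indicator_of_mem h1, indicator_of_mem h2]
          refine le_trans ?_ (le_add_of_nonneg_left zero_le)
          refine le_trans ?_ (le_add_of_nonneg_left zero_le)
          exact add_le_add (mul_le_of_le_one_right' (hf1 _)) (mul_le_of_le_one_right' (hf1 _))
    _ ≤ heatOp v f y' + (η + gaussianReal 0 v S) := by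
        rw [lintegral_add_left (by fun_prop), ← e2, lintegral_add_left (by fun_prop), ← e3]
        gcongr

lemma gaussianReal_tail_le (v : ℝ≥0) :
    gaussianReal 0 v {x | 1 / 2 ≤ |x|} ≤ ENNReal.ofReal (2 * Real.exp (-(1 / 2) ^ 2 / (2 * v))) := by
  have hsub : HasSubgaussianMGF id v (gaussianReal 0 v) :=
    { integrable_exp_mul := fun t => integrable_exp_mul_gaussianReal t
      mgf_le := fun t => by simp [mgf_id_gaussianReal] }
  have h1 := hsub.measure_ge_le (ε := 1 / 2) (by norm_num)
  have h2 := hsub.neg.measure_ge_le (ε := 1 / 2) (by norm_num)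
  have hS : {x : ℝ | 1 / 2 ≤ |x|} ⊆ {x | 1 / 2 ≤ id x} ∪ {x | 1 / 2 ≤ (-id) x} :=
    fun x hx => by simpa [le_abs] using hx
  rw [← ofReal_measureReal]
  refine ENNReal.ofReal_le_ofReal ?_
  refine (measureReal_mono hS).trans ((measureReal_union_le _ _).trans ?_)
  linarith

lemma tendsto_nat_mul_gaussianReal_tail {v : ℝ≥0} (hv : v ≠ 0) :
    Filter.Tendsto (fun n : ℕ => n * gaussianReal 0 (v / n) {x | 1 / 2 ≤ |x|}) Filter.atTop
      (nhds 0) := by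
  have hv' : 0 < (v : ℝ) := by positivity
  have h1 := (Real.tendsto_pow_mul_exp_neg_atTop_nhds_zero 1).comp
    ((tendsto_natCast_atTop_atTop (R := ℝ)).atTop_div_const (r := 8 * (v : ℝ)) (by positivity))
  have h2 := ENNReal.tendsto_ofReal (h1.const_mul (16 * (v : ℝ)))
  rw [mul_zero, ENNReal.ofReal_zero] at h2
  refine tendsto_of_tendsto_of_tendsto_of_le_of_le tendsto_const_nhds h2 (fun _ => zero_le) ?_
  intro n
  calc (n : ℝ≥0∞) * gaussianReal 0 (v / n) {x | 1 / 2 ≤ |x|}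
      ≤ n * ENNReal.ofReal (2 * Real.exp (-(1 / 2) ^ 2 / (2 * (v / n : ℝ≥0)))) := by
        gcongr
        exact gaussianReal_tail_le _
    _ = _ := by
        rw [← ENNReal.ofReal_natCast, ← ENNReal.ofReal_mul (by positivity)]
        simp only [Function.comp, NNReal.coe_div, NNReal.coe_natCast, pow_one]
        rw [show -(1 / 2 : ℝ) ^ 2 / (2 * (v / n)) = -(n / (8 * v)) by
          rw [neg_div, ← mul_div_assoc, div_div_eq_mul_div]; ring]
        congr 1
        field_simp
        ring

/-- The loss of monotonicity adds up over `n` steps of variance `s`. -/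
lemma heatOp_natCast_mul_le_add {s : ℝ≥0} (hs : s ≠ 0) {f : unitInterval → ℝ≥0∞}
    (hf : Measurable f) (hf1 : ∀ y, f y ≤ 1) (hmono : Monotone f) (n : ℕ) :
    ∀ y y', y ≤ y' → heatOp (n * s) f y ≤
      heatOp (n * s) f y' + n * gaussianReal 0 s {x | 1 / 2 ≤ |x|} := by
  induction n with
  | zero =>
    intro y y' h
    simpa [heatOp_zero hf] using hmono h
  | succ n ih =>
    intro y y' h
    rw [Nat.cast_succ, add_one_mul, add_comm _ s, heatOp_add _ _ hf]
    refine (heatOp_le_add hs (measurable_heatOp hf) (heatOp_le_one _ hf1) ih h).trans_eq ?_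
    push_cast
    ring

theorem monotone_heatOp (v : ℝ≥0) {f : unitInterval → ℝ≥0∞} (hf : Measurable f)
    (hf1 : ∀ y, f y ≤ 1) (hmono : Monotone f) : Monotone (heatOp v f) := by
  rcases eq_or_ne v 0 with rfl | hv
  · rwa [heatOp_zero hf]
  intro y y' h
  have hlim := (tendsto_nat_mul_gaussianReal_tail hv).const_add (heatOp v f y')
  rw [add_zero] at hlim
  refine ge_of_tendsto hlim ?_
  filter_upwards [Filter.eventually_ne_atTop 0] with n hn
  have hn' : (n : ℝ≥0) ≠ 0 := by exact_mod_cast hn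
  have := heatOp_natCast_mul_le_add (div_ne_zero hv hn') hf hf1 hmono n y y' h
  rwa [mul_div_cancel₀ _ hn'] at this

/-! ### The mass-transport order -/

lemma Icc_one (r : unitInterval) : Icc r 1 = Ici r := by
  ext x
  simp [unitInterval.le_one']

lemma F_zero (μ : Measure unitInterval) : F 0 μ = μ univ := by
  rw [F, Icc_one]
  congr 1
  ext x
  simp

lemma F_add (r : unitInterval) (μ ν : Measure unitInterval) : F r (μ + ν) = F r μ + F r ν := rfl

/-- `MassLE` compares closed tails `[r,1]`; half-open tails `(r,1]` follow by exhaustion. -/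
lemma MassLE.measure_le {μ ν : Measure unitInterval} (h : MassLE μ ν) {s : Set unitInterval}
    (hs : IsUpperSet s) : μ s ≤ ν s := by
  have hIci (c : unitInterval) : μ (Ici c) ≤ ν (Ici c) := by
    rw [← Icc_one]
    exact h c
  by_cases hc : sInf s ∈ s
  · have : s = Ici (sInf s) :=
      Subset.antisymm (fun x hx => sInf_le hx) fun x hx => hs hx hc
    rw [this]
    exact hIci _
  · have hsc : s = Ioi (sInf s) := by
      refine Subset.antisymm (fun x hx => (sInf_le hx).lt_of_ne ?_) fun x hx => ?_
      · rintro heq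
        exact hc (heq ▸ hx)
      · obtain ⟨y, hy, hyx⟩ := sInf_lt_iff.1 (mem_Ioi.1 hx)
        exact hs hyx.le hy
    rcases s.eq_empty_or_nonempty with rfl | ⟨x, hx⟩
    · simp
    rw [hsc] at hx
    obtain ⟨w, hw, hmem, hlim⟩ := exists_seq_strictAnti_tendsto' (mem_Ioi.1 hx)
    have hU := iUnion_Ici_eq_Ioi_of_lt_of_tendsto (fun n => (hmem n).1) hlim
    have hmono : Monotone fun n => Ici (w n) := fun m n hmn => Ici_subset_Ici.2 (hw.antitone hmn)
    rw [hsc, ← hU, hmono.measure_iUnion, hmono.measure_iUnion]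
    exact iSup_mono fun n => hIci _

/-- `MassLE` is stochastic dominance, by the layer-cake formula. -/
lemma MassLE.lintegral_le {μ ν : Measure unitInterval} (h : MassLE μ ν)
    {f : unitInterval → ℝ≥0∞} (hf1 : ∀ y, f y ≤ 1) (hf : Monotone f) :
    ∫⁻ y, f y ∂μ ≤ ∫⁻ y, f y ∂ν := by
  have hfin (y : unitInterval) : f y ≠ ∞ := ((hf1 y).trans_lt ENNReal.one_lt_top).ne
  have hfm : Measurable fun y => (f y).toReal := hf.measurable.ennreal_toReal
  have key (ρ : Measure unitInterval) :
      ∫⁻ y, f y ∂ρ = ∫⁻ t in Ioi 0, ρ {y | t < (f y).toReal} := by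
    rw [← lintegral_eq_lintegral_meas_lt ρ (Filter.Eventually.of_forall fun y =>
      ENNReal.toReal_nonneg) hfm.aemeasurable]
    exact lintegral_congr fun y => (ENNReal.ofReal_toReal (hfin y)).symm
  rw [key, key]
  refine lintegral_mono fun t => h.measure_le fun x y hxy hx => ?_
  have hx' : t < (f x).toReal := hx
  exact hx'.trans_le (ENNReal.toReal_mono (hfin y) (hf hxy))

/-! ### The Neumann flow on measures -/

lemma F_neumannFlow {t : ℝ} (ht : 0 < t) (μ : Measure unitInterval) [SFinite μ]
    (r : unitInterval) : F r (neumannFlow t μ) =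
      ∫⁻ y, heatOp t.toNNReal ((Ici r).indicator fun _ => 1) y ∂μ := by
  rw [← lintegral_neumannFlow ht μ (measurable_const.indicator measurableSet_Ici),
    lintegral_indicator_const measurableSet_Ici, one_mul, F, Icc_one]

lemma F_zero_neumannFlow {t : ℝ} (ht : 0 < t) (μ : Measure unitInterval) [SFinite μ] :
    F 0 (neumannFlow t μ) = F 0 μ := by
  have h : (Ici (0 : unitInterval)).indicator (fun _ => (1 : ℝ≥0∞)) = fun _ => 1 := by
    ext x
    exact indicator_of_mem (mem_Ici.2 unitInterval.nonneg') _
  rw [F_neumannFlow ht, h, heatOp_one, lintegral_one, F_zero]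

lemma isFiniteMeasure_neumannFlow {t : ℝ} (ht : 0 < t) (μ : Measure unitInterval)
    [IsFiniteMeasure μ] : IsFiniteMeasure (neumannFlow t μ) :=
  ⟨by rw [← F_zero, F_zero_neumannFlow ht, F_zero]; exact measure_lt_top μ _⟩

/-- The semigroup property of the flow, on the level of tails. -/
lemma F_neumannFlow_add {s t : ℝ} (hs : 0 < s) (ht : 0 < t) (μ : Measure unitInterval)
    [IsFiniteMeasure μ] (r : unitInterval) :
    F r (neumannFlow (s + t) μ) = F r (neumannFlow s (neumannFlow t μ)) := by
  have := isFiniteMeasure_neumannFlow ht μ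
  have hm : Measurable ((Ici r).indicator fun _ => (1 : ℝ≥0∞)) :=
    measurable_const.indicator measurableSet_Ici
  rw [F_neumannFlow (add_pos hs ht), F_neumannFlow hs,
    lintegral_neumannFlow ht μ (measurable_heatOp hm), add_comm s, Real.toNNReal_add ht.le hs.le,
    heatOp_add _ _ hm]

lemma MassLE.neumannFlow {t : ℝ} (ht : 0 < t) {μ ν : Measure unitInterval} [SFinite μ] [SFinite ν]
    (h : MassLE μ ν) : MassLE (neumannFlow t μ) (neumannFlow t ν) := by
  intro r
  rw [F_neumannFlow ht, F_neumannFlow ht]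
  have h1 (y : unitInterval) : (Ici r).indicator (fun _ => (1 : ℝ≥0∞)) y ≤ 1 :=
    indicator_le_self' (fun _ _ => zero_le) y
  refine h.lintegral_le (heatOp_le_one _ h1) (monotone_heatOp _
    (measurable_const.indicator measurableSet_Ici) h1 fun x y hxy => ?_)
  by_cases hx : x ∈ Ici r
  · rw [indicator_of_mem hx, indicator_of_mem (mem_Ici.2 (le_trans hx hxy))]
  · rw [indicator_of_notMem hx]
    exact zero_le

lemma F_smul_dirac_one (a : ℝ≥0∞) (r : unitInterval) :
    F r (a • (Measure.dirac 1 : Measure unitInterval)) = a := by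
  simp [F, Icc_one, unitInterval.le_one']

lemma F_neumannFlow_add_dirac_le {t : ℝ} (ht : 0 < t) (ν : Measure unitInterval) [SFinite ν]
    (a : ℝ≥0∞) (r : unitInterval) :
    F r (neumannFlow t (ν + a • Measure.dirac 1)) ≤ F r (neumannFlow t ν) + a := by
  rw [F_neumannFlow ht, lintegral_add_measure, ← F_neumannFlow ht, ← F_neumannFlow ht]
  gcongr
  calc F r (neumannFlow t (a • Measure.dirac 1))
      ≤ F 0 (neumannFlow t (a • Measure.dirac 1)) :=
        measure_mono (Icc_subset_Icc_left unitInterval.nonneg')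
    _ = a := by rw [F_zero_neumannFlow ht, F_smul_dirac_one]

/-- A bound `a` on the excess of the tails of `μ` over those of `ν` persists under the flow, since the
hypothesis means `μ ≤ ν + a D₁`. -/
lemma F_neumannFlow_le_add {t : ℝ} (ht : 0 < t) {μ ν : Measure unitInterval} [SFinite μ]
    [SFinite ν] {a : ℝ≥0∞} (h : ∀ r, F r μ ≤ F r ν + a) (r : unitInterval) :
    F r (neumannFlow t μ) ≤ F r (neumannFlow t ν) + a := by
  refine le_trans (MassLE.neumannFlow ht (ν := ν + a • Measure.dirac 1) (fun s => ?_) r)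
    (F_neumannFlow_add_dirac_le ht ν a r)
  rw [F_add, F_smul_dirac_one]
  exact h s

/-! ### The cut-and-paste operator on tails -/

/-- `ν` arises from `μ` by moving mass `a` from the right end to the point `0`, expressed through
tails: the total mass is kept, and all other tails lose `a`, or everything if they hold less (the
subtraction in `[0,∞]` is truncated). -/
structure IsCut (a : ℝ≥0∞) (μ ν : Measure unitInterval) : Prop where
  zero : F 0 ν = F 0 μ
  of_pos : ∀ r, 0 < r → F r ν = F r μ - a

lemma IsCut.le_add {a : ℝ≥0∞} {μ ν : Measure unitInterval} (h : IsCut a μ ν) (r : unitInterval) :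
    F r μ ≤ F r ν + a := by
  rcases eq_or_lt_of_le (unitInterval.nonneg' (t := r)) with rfl | hr
  · rw [h.zero]
    exact le_self_add
  · rw [h.of_pos r hr]
    exact le_tsub_add

/-- A tail bound with excess `a` becomes a comparison in the order once mass `a` has been cut. -/
lemma IsCut.massLE {a : ℝ≥0∞} {μ ν ρ : Measure unitInterval} (h : IsCut a μ ν)
    (h0 : F 0 μ ≤ F 0 ρ) (hle : ∀ r, F r μ ≤ F r ρ + a) : MassLE ν ρ := by
  intro r
  rcases eq_or_lt_of_le (unitInterval.nonneg' (t := r)) with rfl | hr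
  · rwa [h.zero]
  · rw [h.of_pos r hr]
    exact tsub_le_iff_right.2 (hle r)

lemma continuous_F {μ : Measure unitInterval} [IsFiniteMeasure μ] [NullSingletonClass μ] :
    Continuous fun r => F r μ := by
  have hF (r : unitInterval) : F r μ = ∫⁻ x, (Ici r).indicator (fun _ => 1) x ∂μ := by
    rw [lintegral_indicator_const measurableSet_Ici, one_mul, F, Icc_one]
  simp_rw [hF]
  refine continuous_iff_continuousAt.2 fun r₀ => ?_
  refine tendsto_lintegral_filter_of_dominated_convergence (fun _ => 1)
    (Filter.Eventually.of_forall fun r => measurable_const.indicator measurableSet_Ici)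
    (Filter.Eventually.of_forall fun r => Filter.Eventually.of_forall fun x =>
      indicator_le_self' (fun _ _ => zero_le) x) (by simp) ?_
  filter_upwards [compl_mem_ae_iff.2 (measure_singleton r₀)] with x hx
  rcases lt_or_gt_of_ne (show x ≠ r₀ from hx) with h | h
  · refine tendsto_const_nhds.congr' ?_
    filter_upwards [Ioi_mem_nhds h] with r hr
    rw [indicator_of_notMem (by simpa using h), indicator_of_notMem (by simpa using hr)]
  · refine tendsto_const_nhds.congr' ?_
    filter_upwards [Iio_mem_nhds h] with r hr
    rw [indicator_of_mem (mem_Ici.2 h.le), indicator_of_mem (mem_Ici.2 (mem_Iio.1 hr).le)]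

instance (j δ : ℝ) (μ : Measure unitInterval) [IsFiniteMeasure μ] :
    IsFiniteMeasure (cutPaste j δ μ) := by
  have : IsFiniteMeasure (ENNReal.ofReal (j * δ) • (Measure.dirac 0 : Measure unitInterval)) :=
    Measure.smul_finite _ ENNReal.ofReal_ne_top
  unfold cutPaste
  infer_instance

/-- The infimum defining `cutPoint` is attained: without atoms the tail function is continuous, and it
crosses the level `jδ`. -/
lemma F_cutPoint {j δ : ℝ} {μ : Measure unitInterval} [IsFiniteMeasure μ] [NullSingletonClass μ]
    (h : ENNReal.ofReal (j * δ) < F 0 μ) : F (cutPoint j δ μ) μ = ENNReal.ofReal (j * δ) := by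
  have h1 : F 1 μ = 0 := by simp [F]
  have hne : {r | F r μ = ENNReal.ofReal (j * δ)}.Nonempty :=
    mem_range_of_exists_le_of_exists_ge continuous_F ⟨1, by simp [h1]⟩ ⟨0, h.le⟩
  exact (isClosed_eq continuous_F continuous_const).sInf_mem hne

lemma isCut_cutPaste {j δ : ℝ} {μ : Measure unitInterval} [IsFiniteMeasure μ]
    [NullSingletonClass μ] (h : ENNReal.ofReal (j * δ) < F 0 μ) :
    IsCut (ENNReal.ofReal (j * δ)) μ (cutPaste j δ μ) := by
  set a := ENNReal.ofReal (j * δ) with ha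
  set R := cutPoint j δ μ with hR
  have hFR : F R μ = a := F_cutPoint h
  have hF (r : unitInterval) : F r (cutPaste j δ μ) =
      a * (Icc r 1).indicator 1 0 + μ (Icc r R) := by
    have : Icc r 1 ∩ Icc 0 R = Icc r R := by
      ext x
      simp [unitInterval.le_one']
    rw [F, cutPaste, Measure.add_apply, Measure.smul_apply, Measure.dirac_apply' _ measurableSet_Icc,
      Measure.restrict_apply measurableSet_Icc, this, smul_eq_mul]
  have hsplit {r : unitInterval} (hr : r ≤ R) : F r μ = μ (Icc r R) + a := by
    rw [← hFR, F, F, ← measure_congr (Ioc_ae_eq_Icc (a := R) (b := 1)),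
      ← Icc_union_Ioc_eq_Icc hr unitInterval.le_one',
      measure_union (disjoint_left.2 fun x hx hx' => hx'.1.not_ge hx.2) measurableSet_Ioc]
  refine ⟨?_, fun r hr => ?_⟩
  · rw [hF, indicator_of_mem (left_mem_Icc.2 unitInterval.le_one'),
      hsplit unitInterval.nonneg', Pi.one_apply, mul_one, add_comm]
  · rw [hF, indicator_of_notMem fun h0 => hr.not_ge h0.1, mul_zero, zero_add]
    rcases le_or_gt r R with hrR | hrR
    · exact ENNReal.eq_sub_of_add_eq ENNReal.ofReal_ne_top (hsplit hrR).symm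
    · rw [Icc_eq_empty hrR.not_ge, measure_empty, eq_comm, tsub_eq_zero_iff_le, ← hFR]
      exact measure_mono (Icc_subset_Icc_left hrR.le)

/-! ### Comparison of barriers -/

lemma nullSingletonClass_neumannFlow (t : ℝ) (μ : Measure unitInterval) :
    NullSingletonClass (neumannFlow t μ) := by
  unfold neumannFlow
  infer_instance

section Barrier

variable {j δ : ℝ} {μ : Measure unitInterval}

/-- The lower barrier stays finite and keeps its mass, so that each of its cuts acts on a flowed, hence
atomless, measure with mass above `jδ`. -/
lemma lowerBarrier_spec (hδ : 0 < δ) [IsFiniteMeasure μ]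
    (h : ENNReal.ofReal (j * δ) < F 0 μ) (n : ℕ) :
    IsFiniteMeasure (lowerBarrier j δ μ n) ∧ F 0 (lowerBarrier j δ μ n) = F 0 μ ∧
      IsCut (ENNReal.ofReal (j * δ)) (neumannFlow δ (lowerBarrier j δ μ n))
        (lowerBarrier j δ μ (n + 1)) := by
  have step {ν : Measure unitInterval} [IsFiniteMeasure ν] (hν : F 0 ν = F 0 μ) :
      IsCut (ENNReal.ofReal (j * δ)) (neumannFlow δ ν) (cutPaste j δ (neumannFlow δ ν)) := by
    have := isFiniteMeasure_neumannFlow hδ ν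
    have := nullSingletonClass_neumannFlow δ ν
    refine isCut_cutPaste ?_
    rwa [F_zero_neumannFlow hδ, hν]
  induction n with
  | zero => exact ⟨‹IsFiniteMeasure μ›, rfl, step (ν := μ) rfl⟩
  | succ n ih =>
    obtain ⟨hfin, hmass, hcut⟩ := ih
    have hmass' : F 0 (lowerBarrier j δ μ (n + 1)) = F 0 μ := by
      rw [hcut.zero, F_zero_neumannFlow hδ, hmass]
    have hfin' : IsFiniteMeasure (lowerBarrier j δ μ (n + 1)) := by
      have := isFiniteMeasure_neumannFlow hδ (lowerBarrier j δ μ n)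
      rw [lowerBarrier]
      infer_instance
    exact ⟨hfin', hmass', step hmass'⟩

/-- The upper barrier stays finite and atomless and keeps its mass, so that each of its cuts acts on a
measure with mass above `jδ`. -/
lemma upperBarrier_spec (hδ : 0 < δ) [IsFiniteMeasure μ] [NullSingletonClass μ]
    (h : ENNReal.ofReal (j * δ) < F 0 μ) (n : ℕ) :
    IsFiniteMeasure (upperBarrier j δ μ n) ∧ NullSingletonClass (upperBarrier j δ μ n) ∧
      F 0 (upperBarrier j δ μ n) = F 0 μ ∧
      IsCut (ENNReal.ofReal (j * δ)) (upperBarrier j δ μ n)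
        (cutPaste j δ (upperBarrier j δ μ n)) := by
  induction n with
  | zero => exact ⟨‹IsFiniteMeasure μ›, ‹NullSingletonClass μ›, rfl, isCut_cutPaste (μ := μ) h⟩
  | succ n ih =>
    obtain ⟨hfin, hatom, hmass, hcut⟩ := ih
    have hmass' : F 0 (upperBarrier j δ μ (n + 1)) = F 0 μ := by
      rw [upperBarrier, F_zero_neumannFlow hδ, hcut.zero, hmass]
    have hfin' : IsFiniteMeasure (upperBarrier j δ μ (n + 1)) :=
      isFiniteMeasure_neumannFlow hδ _
    have hatom' : NullSingletonClass (upperBarrier j δ μ (n + 1)) :=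
      nullSingletonClass_neumannFlow _ _
    exact ⟨hfin', hatom', hmass', isCut_cutPaste (by rwa [hmass'])⟩

lemma lowerBarrier_add (m n : ℕ) :
    lowerBarrier j δ μ (m + n) = lowerBarrier j δ (lowerBarrier j δ μ m) n := by
  induction n with
  | zero => rfl
  | succ n ih => rw [← add_assoc, lowerBarrier, lowerBarrier, ih]

lemma upperBarrier_add (m n : ℕ) :
    upperBarrier j δ μ (m + n) = upperBarrier j δ (upperBarrier j δ μ m) n := by
  induction n with
  | zero => rfl
  | succ n ih => rw [← add_assoc, upperBarrier, upperBarrier, ih]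

/-- Comparison for equal time steps; the induction step is `K_a G_δ ≤ G_δ K_a`. -/
lemma lowerBarrier_massLE_upperBarrier (hδ : 0 < δ) [IsFiniteMeasure μ] [NullSingletonClass μ]
    (h : ENNReal.ofReal (j * δ) < F 0 μ) (n : ℕ) :
    MassLE (lowerBarrier j δ μ n) (upperBarrier j δ μ n) := by
  induction n with
  | zero => exact fun _ => le_rfl
  | succ n ih =>
    obtain ⟨hLfin, hLmass, hLcut⟩ := lowerBarrier_spec hδ h n
    obtain ⟨hUfin, hUatom, hUmass, hUcut⟩ := upperBarrier_spec hδ h n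
    refine hLcut.massLE ?_ (F_neumannFlow_le_add hδ fun r => (ih r).trans (hUcut.le_add r))
    rw [F_zero_neumannFlow hδ, upperBarrier, F_zero_neumannFlow hδ, hUcut.zero, hLmass, hUmass]

/-- Flowing for time `nδ` without cuts exceeds `n` steps of the lower barrier by at most the mass
`n jδ` that these steps cut. -/
lemma F_neumannFlow_nat_mul_le_lowerBarrier (hδ : 0 < δ) [IsFiniteMeasure μ]
    (h : ENNReal.ofReal (j * δ) < F 0 μ) {n : ℕ} (hn : 1 ≤ n) :
    ∀ r, F r (neumannFlow (n * δ) μ) ≤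
      F r (lowerBarrier j δ μ n) + n * ENNReal.ofReal (j * δ) := by
  induction n, hn using Nat.le_induction with
  | base =>
    intro r
    simpa [lowerBarrier] using (lowerBarrier_spec hδ h 0).2.2.le_add r
  | succ n hn ih =>
    intro r
    obtain ⟨hfin, hmass, hcut⟩ := lowerBarrier_spec hδ h n
    have hnδ : 0 < n * δ := mul_pos (by exact_mod_cast hn) hδ
    have := isFiniteMeasure_neumannFlow hnδ μ
    rw [Nat.cast_succ, add_one_mul, add_comm _ δ, F_neumannFlow_add hδ hnδ]
    calc F r (neumannFlow δ (neumannFlow (n * δ) μ))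
        ≤ F r (neumannFlow δ (lowerBarrier j δ μ n)) + n * ENNReal.ofReal (j * δ) :=
          F_neumannFlow_le_add hδ ih r
      _ ≤ F r (lowerBarrier j δ μ (n + 1)) + ENNReal.ofReal (j * δ) +
          n * ENNReal.ofReal (j * δ) := by
          gcongr
          exact hcut.le_add r
      _ = _ := by push_cast; ring

/-- `n` steps of the upper barrier lie below the flow for time `nδ` of any measure obtained from `μ` by
lowering the tails by at most `n jδ` without loss of total mass, in particular of the measure that
results from one cut of mass `n jδ`. -/
lemma upperBarrier_massLE_neumannFlow (hδ : 0 < δ) [IsFiniteMeasure μ] [NullSingletonClass μ]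
    (h : ENNReal.ofReal (j * δ) < F 0 μ) {n : ℕ} (hn : 1 ≤ n) :
    ∀ ν : Measure unitInterval, IsFiniteMeasure ν → F 0 μ ≤ F 0 ν →
      (∀ r, F r μ ≤ F r ν + n * ENNReal.ofReal (j * δ)) →
      MassLE (upperBarrier j δ μ n) (neumannFlow (n * δ) ν) := by
  induction n, hn using Nat.le_induction with
  | base =>
    intro ν _ h0 hν
    simp only [Nat.cast_one, one_mul] at hν ⊢
    exact MassLE.neumannFlow hδ (μ := cutPaste j δ μ) ((isCut_cutPaste h).massLE h0 hν)
  | succ n hn ih =>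
    intro ν _ h0 hν
    obtain ⟨hfin, hatom, hmass, hcut⟩ := upperBarrier_spec hδ h n
    have hnδ : 0 < n * δ := mul_pos (by exact_mod_cast hn) hδ
    have := isFiniteMeasure_neumannFlow hnδ ν
    have hdirac : IsFiniteMeasure
        (ENNReal.ofReal (j * δ) • (Measure.dirac 1 : Measure unitInterval)) :=
      Measure.smul_finite _ ENNReal.ofReal_ne_top
    -- Putting mass `jδ` back at `1` turns `ν` into a competitor for `n` steps.
    have hstep := ih (ν + ENNReal.ofReal (j * δ) • Measure.dirac 1) inferInstance
      (h0.trans le_self_add) fun r => (hν r).trans_eq (by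
        rw [F_add, F_smul_dirac_one]; push_cast; ring)
    have hK : MassLE (cutPaste j δ (upperBarrier j δ μ n)) (neumannFlow (n * δ) ν) := by
      refine hcut.massLE ?_ fun r => (hstep r).trans (F_neumannFlow_add_dirac_le hnδ ν _ r)
      rwa [hmass, F_zero_neumannFlow hnδ]
    intro r
    rw [Nat.cast_succ, add_one_mul, add_comm _ δ, F_neumannFlow_add hδ hnδ]
    exact MassLE.neumannFlow hδ hK r

lemma ofReal_mul_nat_mul (m : ℕ) :
    ENNReal.ofReal (j * (m * δ)) = m * ENNReal.ofReal (j * δ) := by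
  rw [mul_left_comm, ENNReal.ofReal_mul m.cast_nonneg, ENNReal.ofReal_natCast]

lemma ofReal_lt_of_nat_mul_lt {m : ℕ} (hm : 1 ≤ m) {b : ℝ≥0∞}
    (h : ENNReal.ofReal (j * (m * δ)) < b) : ENNReal.ofReal (j * δ) < b := by
  refine lt_of_le_of_lt ?_ h
  rw [ofReal_mul_nat_mul]
  exact le_mul_of_one_le_left' (by exact_mod_cast hm)

/-- Refining the time step increases the lower barrier. -/
lemma lowerBarrier_massLE_lowerBarrier (hδ : 0 < δ) [IsFiniteMeasure μ] {m : ℕ} (hm : 1 ≤ m)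
    (h : ENNReal.ofReal (j * (m * δ)) < F 0 μ) (n : ℕ) :
    MassLE (lowerBarrier j (m * δ) μ n) (lowerBarrier j δ μ (n * m)) := by
  have hmδ : 0 < m * δ := mul_pos (by exact_mod_cast hm) hδ
  have hfine := ofReal_lt_of_nat_mul_lt hm h
  induction n with
  | zero => exact fun _ => by rw [zero_mul]; exact le_rfl
  | succ n ih =>
    obtain ⟨hcfin, hcmass, hccut⟩ := lowerBarrier_spec hmδ h n
    obtain ⟨hffin, hfmass, -⟩ := lowerBarrier_spec hδ hfine (n * m)
    have hfmass' := (lowerBarrier_spec hδ hfine ((n + 1) * m)).2.1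
    refine hccut.massLE (by rw [F_zero_neumannFlow hmδ, hcmass, hfmass']) fun r => ?_
    rw [add_one_mul, lowerBarrier_add, ofReal_mul_nat_mul]
    exact (MassLE.neumannFlow hmδ ih r).trans
      (F_neumannFlow_nat_mul_le_lowerBarrier hδ (by rwa [hfmass]) hm r)

/-- Refining the time step decreases the upper barrier. -/
lemma upperBarrier_massLE_upperBarrier (hδ : 0 < δ) [IsFiniteMeasure μ] [NullSingletonClass μ]
    {m : ℕ} (hm : 1 ≤ m) (h : ENNReal.ofReal (j * (m * δ)) < F 0 μ) (n : ℕ) :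
    MassLE (upperBarrier j δ μ (n * m)) (upperBarrier j (m * δ) μ n) := by
  have hmδ : 0 < m * δ := mul_pos (by exact_mod_cast hm) hδ
  have hfine := ofReal_lt_of_nat_mul_lt hm h
  induction n with
  | zero => exact fun _ => by rw [zero_mul]; exact le_rfl
  | succ n ih =>
    obtain ⟨hcfin, hcatom, hcmass, hccut⟩ := upperBarrier_spec hmδ h n
    obtain ⟨hffin, hfatom, hfmass, -⟩ := upperBarrier_spec hδ hfine (n * m)
    rw [add_one_mul, upperBarrier_add]
    refine upperBarrier_massLE_neumannFlow hδ (by rwa [hfmass]) hm _ inferInstance ?_ fun r => ?_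
    · rw [hfmass, hccut.zero, hcmass]
    · rw [← ofReal_mul_nat_mul]
      exact (ih r).trans (hccut.le_add r)

end Barrier

lemma lt_mass_of_mem_UDelta {j δ : ℝ} {μ : Measure unitInterval} (h : μ ∈ UDelta j δ) :
    ENNReal.ofReal (j * δ) < F 0 μ := by
  obtain ⟨c, ρ, -, rfl, hρ⟩ := h
  exact hρ.trans_le le_add_self

lemma IsProfile.isFiniteMeasure_ofDensity {ρ : unitInterval → ℝ} (h : IsProfile ρ) :
    IsFiniteMeasure (ofDensity ρ) :=
  isFiniteMeasure_withDensity_ofReal (h.1.integrable le_top).2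

instance (ρ : unitInterval → ℝ) : NullSingletonClass (ofDensity ρ) := by
  unfold ofDensity
  infer_instance

end Barriers

theorem theorem2p2 (j : ℝ) (hj : 0 < j) (u : unitInterval → ℝ) (hu : Barriers.IsProfile u)
    (hmass : 0 < Barriers.F 0 (Barriers.ofDensity u))
    (δ δ' t : ℝ) (hδ : 0 < δ) (hδ' : 0 < δ')
    (huδ : Barriers.ofDensity u ∈ Barriers.UDelta j δ)
    (huδ' : Barriers.ofDensity u ∈ Barriers.UDelta j δ')
    (k k' : ℕ) (htk : t = k * δ) (htk' : t = k' * δ') :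
    Barriers.MassLE (Barriers.lowerBarrier j δ (Barriers.ofDensity u) k)
      (Barriers.upperBarrier j δ' (Barriers.ofDensity u) k') := by
  have hfin := hu.isFiniteMeasure_ofDensity
  have heq : (k : ℝ) * δ = k' * δ' := htk.symm.trans htk'
  rcases Nat.eq_zero_or_pos k with rfl | hk
  · obtain rfl : k' = 0 := by
      have : (k' : ℝ) * δ' = 0 := by rw [← heq]; simp
      exact_mod_cast (mul_eq_zero.1 this).resolve_right hδ'.ne'
    exact fun _ => le_rfl
  have hkR : (0 : ℝ) < k := by exact_mod_cast hk
  have hk'R : (0 : ℝ) < k' := pos_of_mul_pos_left (heq ▸ mul_pos hkR hδ) hδ'.le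
  have hk' : 0 < k' := by exact_mod_cast hk'R
  -- The common refinement of the two time steps.
  obtain ⟨d, rfl⟩ : ∃ d, δ = k' * d := ⟨δ / k', by field_simp⟩
  obtain rfl : δ' = k * d := by
    refine mul_left_cancel₀ hk'R.ne' ?_
    rw [← heq]
    ring
  have hd : 0 < d := pos_of_mul_pos_right hδ hk'R.le
  have h := Barriers.lt_mass_of_mem_UDelta huδ
  have h' := Barriers.lt_mass_of_mem_UDelta huδ'
  intro r
  calc Barriers.F r (Barriers.lowerBarrier j (k' * d) (Barriers.ofDensity u) k)
      ≤ Barriers.F r (Barriers.lowerBarrier j d (Barriers.ofDensity u) (k * k')) :=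
        Barriers.lowerBarrier_massLE_lowerBarrier hd hk' h k r
    _ ≤ Barriers.F r (Barriers.upperBarrier j d (Barriers.ofDensity u) (k * k')) :=
        Barriers.lowerBarrier_massLE_upperBarrier hd (Barriers.ofReal_lt_of_nat_mul_lt hk' h) _ r
    _ ≤ Barriers.F r (Barriers.upperBarrier j (k * d) (Barriers.ofDensity u) k') := by
        rw [mul_comm]
        exact Barriers.upperBarrier_massLE_upperBarrier hd hk h' k' r
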